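/- A strict partition is a finite strictly decreasing sequence $\lambda=(\lambda_1>\lambda_2>\dots>\lambda_{\ell}>0)$ of positive integers (possibly empty); write $\ell(\lambda)=\ell$ for its length, $|\lambda|=\sum_i\lambda_i$ for its size, and $\mathcal{SP}_n$ for the finite set of strict partitions of size $n$. Its shifted Young diagram is $S(\lambda)=\{(i,j)\in\mathbb{Z}^2 : 1\le i\le \ell(\lambda),\ i\le j\le \lambda_i+i-1\}$. For strict partitions $\lambda,\mu$ with $S(\mu)\subseteq S(\lambda)$ and $k=|\lambda|-|\mu|$, let $g^{\lambda/\mu}$ be the number of sequences $(\lambda^{(0)},\lambda^{(1)},\dots,\lambda^{(k)})$ of strict partitions with $\lambda^{(0)}=\mu$ and $\lambda^{(k)}=\lambda$ such that, for each $i=1,\dots,k$, $S(\lambda^{(i)})$ is obtained from $S(\lambda^{(i-1)})$ by adding exactly one box; put $g^{\lambda/\mu}=0$ if $S(\mu)\not\subseteq S(\lambda)$, and $g^\lambda=g^{\lambda/\emptyset}$. Let $\Gamma$ be the subalgebra, generated over $\mathbb{Q}$ by the odd power sums $p_{2k+1}=\sum_{i\ge1}x_i^{2k+1}$ ($k=0,1,2,\dots$),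 of the algebra of symmetric functions with rational coefficients in $x_1,x_2,\dots$; its elements are called supersymmetric functions. For $f\in\Gamma$ and a strict partition $\lambda$ put $f(\lambda)=f(\lambda_1,\dots,\lambda_{\ell(\lambda)},0,0,\dots)$. **Theorem 1.2.** Let $\mu$ be a strict partition, let $m=|\mu|$, and let $f\in\Gamma$ be a supersymmetric function. Then $$\mathbb{E}_{\mu,n}[f]=\sum_{\lambda\in\mathcal{SP}_{n+m}}\frac{m!}{(n+m)!}\,2^{\,n-\ell(\lambda)+\ell(\mu)}\,\frac{g^\lambda}{g^\mu}\,g^{\lambda/\mu}\,f(\lambda)$$ is a polynomial function of $n$: there is a polynomial $p\in\mathbb{Q}[x]$, depending only on $\mu$ and $f$, such that $\mathbb{E}_{\mu,n}[f]=p(n)$ for every integer $n\ge0$. -/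

import Mathlib

namespace ShiftedPlancherel

/-- A strict partition: a finite strictly decreasing sequence of positive integers. -/
@[ext]
structure StrictPartition where
  parts : List ℕ
  strict : parts.Pairwise (fun a b => b < a)
  pos : ∀ a ∈ parts, 0 < a

namespace StrictPartition

/-- The length `ℓ(ν)`, i.e. the number of parts. -/
def length (ν : StrictPartition) : ℕ := ν.parts.length

/-- The size `|ν|`, i.e. the sum of the parts. -/
def size (ν : StrictPartition) : ℕ := ν.parts.sum

/-- The empty partition. -/
def empty : StrictPartition := ⟨[], List.Pairwise.nil, by simp⟩

theorem finite_setOf_size_eq (n : ℕ) : {ν : StrictPartition | ν.size = n}.Finite := by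
  refine Set.Finite.of_finite_image (f := fun ν => ν.parts.toFinset) ?_ ?_
  · refine (Finset.finite_toSet (Finset.range (n + 1)).powerset).subset ?_
    rintro _ ⟨ν, hν, rfl⟩
    simp only [Finset.coe_powerset, Set.mem_preimage, Set.mem_powerset_iff, Finset.coe_subset]
    intro a ha
    have h1 := List.le_sum_of_mem (List.mem_toFinset.1 ha)
    have h2 : ν.parts.sum = n := hν
    simp only [Finset.mem_range]
    omega
  · intro ν _ κ _ h
    have hν : ν.parts.Nodup := ν.strict.imp (fun h => (ne_of_lt h).symm)
    have hκ : κ.parts.Nodup := κ.strict.imp (fun h => (ne_of_lt h).symm)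
    have hp : ν.parts.Perm κ.parts := List.perm_of_nodup_nodup_toFinset_eq hν hκ h
    exact StrictPartition.ext
      (hp.eq_of_pairwise (fun a b _ _ h1 h2 => absurd h1 (Nat.lt_asymm h2)) ν.strict κ.strict)

/-- The finite set `SP_n` of all strict partitions of `n`. -/
noncomputable def ofSize (n : ℕ) : Finset StrictPartition :=
  (finite_setOf_size_eq n).toFinset

theorem mem_ofSize {n : ℕ} {ν : StrictPartition} : ν ∈ ofSize n ↔ ν.size = n := by
  simp [ofSize]

/-- The shifted Young diagram
`S(ν) = {(i, j) ∈ ℤ² : 1 ≤ i ≤ ℓ(ν), i ≤ j ≤ ν_i + i - 1}`. The list `ν.parts` is indexed from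
zero, so the part `ν_i` is the entry of index `k` with `i = k + 1`. -/
def diagram (ν : StrictPartition) : Set (ℤ × ℤ) :=
  {b | ∃ k : Fin ν.parts.length,
    b.1 = (k : ℤ) + 1 ∧ b.1 ≤ b.2 ∧ b.2 ≤ (ν.parts.get k : ℤ) + b.1 - 1}

/-- `AddsOneBox ν κ`: the diagram `S(κ)` is obtained from `S(ν)` by adding exactly one box. -/
def AddsOneBox (ν κ : StrictPartition) : Prop :=
  ∃ b, b ∉ ν.diagram ∧ κ.diagram = insert b ν.diagram

/-- The standard tableaux of shape `S(ν/μ)`: sequences `(ν⁽⁰⁾, …, ν⁽ᵏ⁾)`, `k = |ν| - |μ|`, of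
strict partitions from `μ` to `ν`, in which each step adds exactly one box. (Only used when
`S(μ) ⊆ S(ν)`, so the subtraction does not truncate.) -/
def standardTableaux (ν μ : StrictPartition) :
    Set (Fin (ν.size - μ.size + 1) → StrictPartition) :=
  {T | T 0 = μ ∧ T (Fin.last _) = ν ∧
    ∀ i : Fin (ν.size - μ.size), AddsOneBox (T i.castSucc) (T i.succ)}

open Classical in
/-- `g^{ν/μ}`: the number of standard tableaux of shape `S(ν/μ)`, and zero
unless `S(μ) ⊆ S(ν)`. -/
noncomputable def numSkewTableaux (ν μ : StrictPartition) : ℕ :=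
  if μ.diagram ⊆ ν.diagram then (standardTableaux ν μ).ncard else 0

/-- `g^ν = g^{ν/∅}`. -/
noncomputable def numTableaux (ν : StrictPartition) : ℕ := numSkewTableaux ν empty

end StrictPartition

/-- The weight
`P_{μ,n}(ν) = m!/(n+m)! · 2^{n - ℓ(ν) + ℓ(μ)} · (g^ν / g^μ) · g^{ν/μ}`, where `m = |μ|`. -/
noncomputable def weight (μ : StrictPartition) (n : ℕ) (ν : StrictPartition) : ℚ :=
  ((μ.size).factorial : ℚ) / ((n + μ.size).factorial : ℚ)
    * (2 : ℚ) ^ ((n : ℤ) - (ν.length : ℤ) + (μ.length : ℤ))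
    * ((ν.numTableaux : ℚ) / (μ.numTableaux : ℚ))
    * (ν.numSkewTableaux μ : ℚ)

/-- The average `E_{μ,n}[φ] = ∑_{ν ∈ SP_{n+m}} P_{μ,n}(ν) φ(ν)`, where `m = |μ|`. -/
noncomputable def average (μ : StrictPartition) (n : ℕ) (φ : StrictPartition → ℚ) : ℚ :=
  ∑ ν ∈ StrictPartition.ofSize (n + μ.size), weight μ n ν * φ ν

/-- The substitution `F(x_1, …, x_N, x_{N+1}) ↦ F(x_1, …, x_N, 0)`. -/
noncomputable def setLastZero (N : ℕ) :
    MvPolynomial (Fin (N + 1)) ℚ →ₐ[ℚ] MvPolynomial (Fin N) ℚ :=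
  MvPolynomial.aeval
    (Fin.snoc (α := fun _ => MvPolynomial (Fin N) ℚ) (fun i => MvPolynomial.X i) 0)

/-- The `ℚ`-algebra of symmetric functions: families `F = (F_N)` of symmetric polynomials with
rational coefficients in `x_1, …, x_N`, of bounded degree, satisfying the stability relation
`F_{N+1}(x_1, …, x_N, 0) = F_N(x_1, …, x_N)`. -/
noncomputable def symmetricFunctions :
    Subalgebra ℚ (∀ N : ℕ, MvPolynomial (Fin N) ℚ) where
  carrier := {F | (∀ N, (F N).IsSymmetric) ∧ (∀ N, setLastZero N (F (N + 1)) = F N) ∧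
    ∃ d : ℕ, ∀ N, (F N).totalDegree ≤ d}
  mul_mem' := by
    rintro F G ⟨hF, hF', d, hd⟩ ⟨hG, hG', e, he⟩
    refine ⟨fun N => (hF N).mul (hG N), fun N => ?_, d + e, fun N => ?_⟩
    · simp [hF', hG']
    · exact (MvPolynomial.totalDegree_mul _ _).trans (add_le_add (hd N) (he N))
  add_mem' := by
    rintro F G ⟨hF, hF', d, hd⟩ ⟨hG, hG', e, he⟩
    refine ⟨fun N => (hF N).add (hG N), fun N => ?_, max d e, fun N => ?_⟩
    · simp [hF', hG']
    · exact (MvPolynomial.totalDegree_add _ _).trans (max_le_max (hd N) (he N))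
  algebraMap_mem' := by
    intro c
    refine ⟨fun N => MvPolynomial.IsSymmetric.C c, fun N => ?_, 0, fun N => ?_⟩
    · exact (setLastZero N).commutes c
    · exact (MvPolynomial.totalDegree_C c).le

/-- The power sum `p_r = x_1^r + x_2^r + ⋯`, for `r ≥ 1`. -/
noncomputable def powerSum (r : ℕ+) : symmetricFunctions :=
  ⟨fun N => MvPolynomial.psum (Fin N) ℚ r,
    fun N => MvPolynomial.psum_isSymmetric (Fin N) ℚ r,
    fun N => by simp [setLastZero, MvPolynomial.psum, Fin.sum_univ_castSucc],
    (r : ℕ), fun N => by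
      unfold MvPolynomial.psum
      refine MvPolynomial.totalDegree_finsetSum_le (fun i _ => ?_)
      simp [MvPolynomial.totalDegree_X_pow]⟩

/-- The algebra `Γ` of supersymmetric functions: the subalgebra of the algebra of symmetric
functions generated by the odd power sums `p_1, p_3, p_5, …`. -/
noncomputable def supersymmetricFunctions : Subalgebra ℚ symmetricFunctions :=
  Algebra.adjoin ℚ (Set.range fun k : ℕ => powerSum ⟨2 * k + 1, Nat.succ_pos _⟩)

/-- The value `f(ν) = f(ν_1, …, ν_ℓ, 0, 0, …)`; by stability this is the value of the
polynomial in `ℓ = ℓ(ν)` variables at the parts of `ν`. -/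
noncomputable def evalAt (f : symmetricFunctions) (ν : StrictPartition) : ℚ :=
  MvPolynomial.eval (fun i : Fin ν.length => (ν.parts.get i : ℚ)) (f.1 ν.length)

end ShiftedPlancherel

/-!
The averages `average μ n` are the expectations of the Plancherel growth process on strict
partitions, started at `μ`, after `n` steps. By Schur's product formula (`numTableaux_eq`) for the
number of shifted standard tableaux, one step of the process turns a function `f` of the set `s` of
parts into `growth f`, where a row of length `x` (with `x = 0` for a new row) is lengthened with
probability `transition s x`, so that `average μ (n + 1) f = average μ n (growth f)`
(`average_succ`). It remains to see that `growth - 1` is locally nilpotent on the functions coming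
from `Γ`.

Both steps rest on the numbers `u = x (x + 1)`. The probability `transition s x` is the residue at
`z = u` of `z⁻¹ ∏ (z - y (y - 1)) / (z - y (y + 1))`, the product being over `y ∈ s`. Hence the
moments `∑ transition s x * u ^ j` are the coefficients of this product in powers of `z⁻¹`
(`coeff_momentSeries`). The logarithmic derivative has coefficients
`∑ ((y (y + 1)) ^ j - (y (y - 1)) ^ j)`, which are linear combinations of odd power sums, so by
Newton's identities the moments lie in `Γ` (`hasDegreeLE_coeff_momentSeries`). On the other hand
`(x + 1) ^ (2k + 1) - x ^ (2k + 1)` is a polynomial of degree `k` in `u`.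

Give `p_{2k+1}` the degree `k + 1` and `u` the degree `1`. Then the `j`-th moment has degree at most
`j`, while adding a box changes a function of degree `d` by a polynomial in `u` of total degree less
than `d` (`HasDegreeLE.exists_increment`). So `growth - 1` lowers the degree
(`HasDegreeLE.exists_growth_eq`), and since polynomials have polynomial antidifferences, induction
on the degree gives the result (`HasDegreeLE.exists_polynomial_average`).

The product formula itself follows by induction from the recursion over the removal of a box, which
becomes the evaluation of the sum of the residues of `∏ (z - y (y + 1)) / (z - y (y - 1))`
(`sum_residues`).
-/

namespace ShiftedPlancherel

namespace StrictPartition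

/-! ### Strict partitions as finite sets -/

/-- The set of parts of a strict partition. -/
def toFinset (ν : StrictPartition) : Finset ℕ := ν.parts.toFinset

theorem mem_toFinset {ν : StrictPartition} {a : ℕ} : a ∈ ν.toFinset ↔ a ∈ ν.parts :=
  List.mem_toFinset

theorem zero_notMem_toFinset (ν : StrictPartition) : 0 ∉ ν.toFinset := fun h =>
  lt_irrefl _ (ν.pos 0 (mem_toFinset.1 h))

theorem nodup_parts (ν : StrictPartition) : ν.parts.Nodup :=
  ν.strict.imp fun h => (ne_of_lt h).symm

theorem toFinset_injective : Function.Injective toFinset := fun ν κ h =>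
  StrictPartition.ext
    ((List.perm_of_nodup_nodup_toFinset_eq ν.nodup_parts κ.nodup_parts h).eq_of_pairwise
      (fun _ _ _ _ h1 h2 => absurd h1 (Nat.lt_asymm h2)) ν.strict κ.strict)

theorem card_toFinset (ν : StrictPartition) : ν.toFinset.card = ν.length :=
  List.toFinset_card_of_nodup ν.nodup_parts

theorem sum_toFinset {M : Type*} [AddCommMonoid M] (ν : StrictPartition) (F : ℕ → M) :
    ∑ x ∈ ν.toFinset, F x = (ν.parts.map F).sum :=
  List.sum_toFinset F ν.nodup_parts

theorem sum_toFinset_id (ν : StrictPartition) : ∑ x ∈ ν.toFinset, x = ν.size := by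
  rw [sum_toFinset, List.map_id', size]

/-- The strict partition whose parts are the nonzero elements of `s`. -/
def ofFinset (s : Finset ℕ) : StrictPartition where
  parts := (s.erase 0).sort (· ≥ ·)
  strict := (Finset.sortedGT_sort _).pairwise
  pos _ ha := Nat.pos_of_ne_zero (Finset.ne_of_mem_erase ((Finset.mem_sort _).1 ha))

theorem toFinset_ofFinset {s : Finset ℕ} (hs : 0 ∉ s) : (ofFinset s).toFinset = s := by
  simp [toFinset, ofFinset, Finset.erase_eq_of_notMem hs]

/-! ### Adding a box -/

/-- The length of the row of index `k` (counted from zero) of the diagram; it is zero below the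
last row. -/
def row (ν : StrictPartition) (k : ℕ) : ℕ := ν.parts.getD k 0

theorem row_of_lt {ν : StrictPartition} {k : ℕ} (hk : k < ν.parts.length) :
    ν.row k = ν.parts[k] := by
  simp [row, hk]

theorem row_of_le {ν : StrictPartition} {k : ℕ} (hk : ν.parts.length ≤ k) : ν.row k = 0 := by
  simp [row, hk]

theorem row_pos_iff {ν : StrictPartition} {k : ℕ} : 0 < ν.row k ↔ k < ν.parts.length := by
  constructor
  · intro h
    by_contra hk
    rw [row_of_le (not_lt.1 hk)] at h
    exact lt_irrefl _ h
  · intro h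
    rw [row_of_lt h]
    exact ν.pos _ (List.getElem_mem h)

theorem mem_toFinset_iff_row {ν : StrictPartition} {a : ℕ} :
    a ∈ ν.toFinset ↔ 0 < a ∧ ∃ k, ν.row k = a := by
  rw [mem_toFinset]
  constructor
  · intro h
    obtain ⟨k, hk, rfl⟩ := List.getElem_of_mem h
    exact ⟨ν.pos _ h, k, row_of_lt hk⟩
  · rintro ⟨h, k, rfl⟩
    rw [row_of_lt (row_pos_iff.1 h)]
    exact List.getElem_mem _

theorem eq_of_row_eq {ν : StrictPartition} {k l : ℕ} (h : 0 < ν.row k) (hkl : ν.row k = ν.row l) :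
    k = l := by
  have hl : 0 < ν.row l := hkl ▸ h
  rw [row_of_lt (row_pos_iff.1 h), row_of_lt (row_pos_iff.1 hl)] at hkl
  exact (ν.nodup_parts.getElem_inj_iff).1 hkl

theorem mem_diagram {ν : StrictPartition} {i j : ℤ} :
    (i, j) ∈ ν.diagram ↔ ∃ k : ℕ, i = k + 1 ∧ i ≤ j ∧ j < i + ν.row k := by
  constructor
  · rintro ⟨k, h1, h2, h3⟩
    refine ⟨k, h1, h2, ?_⟩
    rw [row_of_lt k.2]
    simp only [List.get_eq_getElem] at h3
    omega
  · rintro ⟨k, h1, h2, h3⟩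
    have hk : 0 < ν.row k := by omega
    refine ⟨⟨k, row_pos_iff.1 hk⟩, h1, h2, ?_⟩
    rw [row_of_lt (row_pos_iff.1 hk)] at h3
    simp only [List.get_eq_getElem]
    omega

theorem mem_diagram_row {ν : StrictPartition} {k : ℕ} {j : ℤ} :
    ((k : ℤ) + 1, j) ∈ ν.diagram ↔ (k : ℤ) + 1 ≤ j ∧ j < k + 1 + ν.row k := by
  rw [mem_diagram]
  constructor
  · rintro ⟨l, h1, h2, h3⟩
    obtain rfl : k = l := by omega
    exact ⟨h2, h3⟩
  · rintro ⟨h2, h3⟩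
    exact ⟨k, rfl, h2, h3⟩

/-- Adding a box lengthens exactly one row, by one. -/
theorem addsOneBox_iff_row {ν κ : StrictPartition} :
    AddsOneBox ν κ ↔ ∃ k, κ.row = Function.update ν.row k (ν.row k + 1) := by
  constructor
  · rintro ⟨⟨i, j⟩, hb, h⟩
    have hmem : (i, j) ∈ κ.diagram := h ▸ Set.mem_insert _ _
    obtain ⟨k, rfl, h2, h3⟩ := mem_diagram.1 hmem
    have key : ∀ (l : ℕ) (j' : ℤ), ((l : ℤ) + 1 ≤ j' ∧ j' < l + 1 + κ.row l) ↔
        ((l = k ∧ j' = j) ∨ ((l : ℤ) + 1 ≤ j' ∧ j' < l + 1 + ν.row l)) := by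
      intro l j'
      rw [← mem_diagram_row, ← mem_diagram_row, h, Set.mem_insert_iff, Prod.mk.injEq]
      simp
    rw [mem_diagram_row] at hb
    refine ⟨k, funext fun l => ?_⟩
    -- compare membership of the box just beyond the end of a row
    by_cases hl : l = k
    · subst hl
      rw [Function.update_self]
      have a1 := key l (l + 1 + ν.row l)
      have a2 := key l (l + 1 + ν.row l + 1)
      omega
    · rw [Function.update_of_ne hl]
      have a1 := key l (l + 1 + ν.row l)
      have a2 := key l (l + 1 + κ.row l)
      omega
  · rintro ⟨k, hk⟩
    refine ⟨((k : ℤ) + 1, (k : ℤ) + 1 + ν.row k), fun h => ?_, Set.ext ?_⟩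
    · have := (mem_diagram_row.1 h).2
      omega
    · rintro ⟨i, j⟩
      rw [Set.mem_insert_iff, Prod.mk.injEq, mem_diagram, mem_diagram, hk]
      constructor
      · rintro ⟨l, rfl, h2, h3⟩
        by_cases hl : l = k
        · subst hl
          rw [Function.update_self] at h3
          by_cases hj : j = (l : ℤ) + 1 + ν.row l
          · exact Or.inl ⟨rfl, hj⟩
          · exact Or.inr ⟨l, rfl, h2, by omega⟩
        · rw [Function.update_of_ne hl] at h3
          exact Or.inr ⟨l, rfl, h2, h3⟩
      · rintro (⟨rfl, rfl⟩ | ⟨l, rfl, h2, h3⟩)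
        · exact ⟨k, rfl, by omega, by rw [Function.update_self]; omega⟩
        · refine ⟨l, rfl, h2, ?_⟩
          by_cases hl : l = k
          · subst hl
            rw [Function.update_self]
            omega
          · rwa [Function.update_of_ne hl]

/-- The set of parts after a box is added to the row of length `x`; for `x = 0`, a new row of
length one is created. -/
def moveUp (s : Finset ℕ) (x : ℕ) : Finset ℕ := insert (x + 1) (s.erase x)

theorem zero_notMem_moveUp {s : Finset ℕ} (hs : 0 ∉ s) (x : ℕ) : 0 ∉ moveUp s x := by
  simp [moveUp, hs]

/-- The lengths of the rows to which a box can be added, when `s` is the set of parts. -/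
def addable (s : Finset ℕ) : Finset ℕ := (insert 0 s).filter fun x => x + 1 ∉ s

theorem mem_addable {s : Finset ℕ} {x : ℕ} : x ∈ addable s ↔ (x = 0 ∨ x ∈ s) ∧ x + 1 ∉ s := by
  simp [addable]

theorem moveUp_injOn (s : Finset ℕ) : Set.InjOn (moveUp s) (addable s) := by
  intro x hx y hy h
  have h1 : y + 1 ∈ moveUp s x := h ▸ Finset.mem_insert_self _ _
  have h2 := (mem_addable.1 hy).2
  rcases Finset.mem_insert.1 h1 with h1 | h1
  · exact (Nat.succ_injective h1).symm
  · exact absurd (Finset.mem_of_mem_erase h1) h2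

theorem toFinset_eq_moveUp_of_row {ν κ : StrictPartition} {k : ℕ}
    (hk : κ.row = Function.update ν.row k (ν.row k + 1)) :
    ν.row k ∈ addable ν.toFinset ∧ κ.toFinset = moveUp ν.toFinset (ν.row k) := by
  have hkk : κ.row k = ν.row k + 1 := by rw [hk, Function.update_self]
  have hne : ∀ l, l ≠ k → κ.row l = ν.row l := fun l hl => by rw [hk, Function.update_of_ne hl]
  refine ⟨mem_addable.2 ⟨?_, ?_⟩, Finset.ext fun a => ?_⟩
  · rcases Nat.eq_zero_or_pos (ν.row k) with h | h
    · exact Or.inl h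
    · exact Or.inr (mem_toFinset_iff_row.2 ⟨h, k, rfl⟩)
  · intro h
    obtain ⟨-, l, hl⟩ := mem_toFinset_iff_row.1 h
    have hlk : l ≠ k := by rintro rfl; omega
    exact hlk (eq_of_row_eq (ν := κ) (by rw [hne l hlk]; omega) (by rw [hne l hlk, hl, hkk]))
  · rw [mem_toFinset_iff_row, moveUp, Finset.mem_insert, Finset.mem_erase, mem_toFinset_iff_row]
    constructor
    · rintro ⟨ha, l, rfl⟩
      by_cases hl : l = k
      · subst hl
        exact Or.inl hkk
      · rw [hne l hl] at ha ⊢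
        exact Or.inr ⟨fun h => hl (eq_of_row_eq ha h), ha, l, rfl⟩
    · rintro (rfl | ⟨h1, h2, l, rfl⟩)
      · exact ⟨Nat.succ_pos _, k, hkk⟩
      · exact ⟨h2, l, hne l fun h => h1 (h ▸ rfl)⟩

/-- Every row whose length does not occur one larger can be lengthened. -/
theorem exists_row_eq_update {ν : StrictPartition} {x : ℕ} (hx : x ∈ addable ν.toFinset) :
    ∃ (κ : StrictPartition) (k : ℕ), ν.row k = x ∧
      κ.row = Function.update ν.row k (ν.row k + 1) := by
  obtain ⟨h0, h1⟩ := mem_addable.1 hx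
  rcases Nat.eq_zero_or_pos x with rfl | hpos
  · refine ⟨⟨ν.parts ++ [1], ?_, ?_⟩, ν.parts.length, row_of_le le_rfl, funext fun l => ?_⟩
    · refine List.pairwise_append.2 ⟨ν.strict, List.pairwise_singleton _ _, fun a ha b hb => ?_⟩
      rw [List.mem_singleton.1 hb]
      have ha1 : a ≠ 0 + 1 := by
        rintro rfl
        exact h1 (mem_toFinset.2 ha)
      have := ν.pos a ha
      omega
    · intro a ha
      rcases List.mem_append.1 ha with ha | ha
      · exact ν.pos a ha
      · rw [List.mem_singleton.1 ha]; exact Nat.one_pos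
    · rw [row_of_le le_rfl]
      rcases lt_trichotomy l ν.parts.length with hl | rfl | hl
      · rw [Function.update_of_ne hl.ne, row_of_lt hl]
        simp [row, List.getElem?_append, hl]
      · simp [row]
      · rw [Function.update_of_ne hl.ne', row_of_le hl.le, row_of_le]
        simp
        omega
  · obtain ⟨-, k, hk⟩ := mem_toFinset_iff_row.1 (h0.resolve_left hpos.ne')
    have hkl : k < ν.parts.length := row_pos_iff.1 (hk ▸ hpos)
    have hkx : ν.parts[k] = x := by rw [← row_of_lt hkl, hk]
    refine ⟨⟨ν.parts.set k (x + 1), ?_, ?_⟩, k, hk, funext fun l => ?_⟩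
    · rw [List.pairwise_iff_getElem]
      intro i j hi hj hij
      rw [List.length_set] at hi hj
      have hst := List.pairwise_iff_getElem.1 ν.strict
      have hij' := hst i j hi hj hij
      rw [List.getElem_set, List.getElem_set]
      split_ifs with hkj hki hki
      · omega
      · subst hkj
        have : ν.parts[i] ≠ x + 1 := fun h => h1 (mem_toFinset.2 (h ▸ List.getElem_mem hi))
        omega
      · subst hki
        omega
      · exact hij'
    · intro a ha
      rcases List.mem_or_eq_of_mem_set ha with ha | rfl
      · exact ν.pos a ha
      · exact Nat.succ_pos _
    · rw [hk]
      by_cases hl : l = k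
      · subst hl
        simp [row, hkl]
      · rw [Function.update_of_ne hl]
        simp [row, Ne.symm hl]

/-- Adding a box, in terms of the sets of parts. -/
theorem addsOneBox_iff {ν κ : StrictPartition} :
    AddsOneBox ν κ ↔ ∃ x ∈ addable ν.toFinset, κ.toFinset = moveUp ν.toFinset x := by
  rw [addsOneBox_iff_row]
  constructor
  · rintro ⟨k, hk⟩
    exact ⟨_, toFinset_eq_moveUp_of_row hk⟩
  · rintro ⟨x, hx, h⟩
    obtain ⟨κ', k, rfl, hk⟩ := exists_row_eq_update hx
    obtain rfl : κ = κ' := toFinset_injective (h.trans (toFinset_eq_moveUp_of_row hk).2.symm)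
    exact ⟨k, hk⟩

theorem sum_moveUp {s : Finset ℕ} {x : ℕ} (hx : x ∈ addable s) {M : Type*} [AddCommGroup M]
    {F : ℕ → M} (hF : F 0 = 0) :
    ∑ y ∈ moveUp s x, F y = ∑ y ∈ s, F y + (F (x + 1) - F x) := by
  obtain ⟨h0, h1⟩ := mem_addable.1 hx
  rw [moveUp, Finset.sum_insert fun h => h1 (Finset.mem_of_mem_erase h)]
  by_cases h : x ∈ s
  · rw [← Finset.add_sum_erase s F h]
    abel
  · obtain rfl := h0.resolve_right h
    rw [Finset.erase_eq_of_notMem h, hF]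
    abel

theorem AddsOneBox.size_eq {ν κ : StrictPartition} (h : AddsOneBox ν κ) :
    κ.size = ν.size + 1 := by
  obtain ⟨x, hx, hκ⟩ := addsOneBox_iff.1 h
  have := sum_moveUp hx (F := fun y => (y : ℤ)) rfl
  rw [← hκ] at this
  rw [← sum_toFinset_id, ← sum_toFinset_id]
  push_cast at this
  zify
  linarith

/-! ### Counting standard tableaux -/

/-- The chains of `k + 1` strict partitions from `μ` to `ν` in which each step adds one box. -/
def chains (k : ℕ) (μ ν : StrictPartition) : Set (Fin (k + 1) → StrictPartition) :=
  {T | T 0 = μ ∧ T (Fin.last _) = ν ∧ ∀ i : Fin k, AddsOneBox (T i.castSucc) (T i.succ)}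

open Classical in
/-- The strict partitions obtained from `ν` by removing one box. -/
noncomputable def predecessors (ν : StrictPartition) : Finset StrictPartition :=
  (ofSize (ν.size - 1)).filter fun κ => AddsOneBox κ ν

theorem mem_predecessors {ν κ : StrictPartition} : κ ∈ predecessors ν ↔ AddsOneBox κ ν := by
  classical
  rw [predecessors, Finset.mem_filter, mem_ofSize]
  refine ⟨And.right, fun h => ⟨?_, h⟩⟩
  rw [h.size_eq, Nat.add_sub_cancel]

/-- A nonconstant chain consists of its initial part, ending one box short, and its last term. -/
noncomputable def chainsSuccEquiv (k : ℕ) (μ ν : StrictPartition) :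
    chains (k + 1) μ ν ≃ Σ κ : predecessors ν, chains k μ κ where
  toFun T := ⟨⟨T.1 (Fin.last k).castSucc, mem_predecessors.2 (by
      have h := T.2.2.2 (Fin.last k)
      rwa [Fin.succ_last, T.2.2.1] at h)⟩,
    fun i => T.1 i.castSucc, T.2.1, rfl, fun i => T.2.2.2 i.castSucc⟩
  invFun p := ⟨Fin.snoc (α := fun _ => StrictPartition) p.2.1 ν, by
    refine ⟨?_, Fin.snoc_last _ _, fun i => ?_⟩
    · rw [← Fin.castSucc_zero, Fin.snoc_castSucc]
      exact p.2.2.1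
    · refine Fin.lastCases ?_ (fun i => ?_) i
      · rw [Fin.succ_last, Fin.snoc_last, Fin.snoc_castSucc, p.2.2.2.1]
        exact mem_predecessors.1 p.1.2
      · rw [Fin.succ_castSucc, Fin.snoc_castSucc, Fin.snoc_castSucc]
        exact p.2.2.2.2 i⟩
  left_inv := by
    rintro ⟨T, h0, h1, h2⟩
    ext1
    funext i
    refine Fin.lastCases ?_ (fun i => ?_) i
    · simp [h1]
    · simp
  right_inv p := by
    have ext : ∀ p q : Σ κ : predecessors ν, chains k μ κ, p.2.1 = q.2.1 → p = q := by
      rintro ⟨⟨κ, hκ⟩, ⟨T, hT⟩⟩ ⟨⟨κ', hκ'⟩, ⟨T', hT'⟩⟩ h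
      obtain rfl : T = T' := h
      obtain rfl : κ = κ' := hT.2.1.symm.trans hT'.2.1
      rfl
    exact ext _ _ (funext fun i => by simp)

theorem finite_chains (k : ℕ) (μ ν : StrictPartition) : Finite (chains k μ ν) := by
  induction k generalizing ν with
  | zero =>
    have : Subsingleton (chains 0 μ ν) := ⟨fun S T => Subtype.ext (funext fun i => by
      rw [Fin.fin_one_eq_zero i, S.2.1, T.2.1])⟩
    infer_instance
  | succ k ih =>
    have := fun κ : predecessors ν => ih κ
    exact Finite.of_equiv _ (chainsSuccEquiv k μ ν).symm

theorem ncard_chains_succ (k : ℕ) (μ ν : StrictPartition) :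
    (chains (k + 1) μ ν).ncard = ∑ κ ∈ predecessors ν, (chains k μ κ).ncard := by
  have := fun κ : predecessors ν => finite_chains k μ κ
  rw [← Nat.card_coe_set_eq, Nat.card_congr (chainsSuccEquiv k μ ν), Nat.card_sigma]
  exact Finset.sum_coe_sort _ fun κ => (chains k μ κ).ncard

theorem diagram_subset_of_mem_chains {k : ℕ} {μ ν : StrictPartition}
    {T : Fin (k + 1) → StrictPartition} (hT : T ∈ chains k μ ν) : μ.diagram ⊆ ν.diagram := by
  obtain ⟨rfl, rfl, h⟩ := hT
  have key : ∀ i : Fin (k + 1), (T 0).diagram ⊆ (T i).diagram := by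
    intro i
    induction i using Fin.induction with
    | zero => exact subset_rfl
    | succ i ih =>
      obtain ⟨b, -, hb⟩ := h i
      exact ih.trans (hb ▸ Set.subset_insert _ _)
  exact key _

/-- The containment of diagrams need not be required separately: without it there are no
tableaux. -/
theorem numSkewTableaux_eq_ncard_chains (ν μ : StrictPartition) :
    numSkewTableaux ν μ = (chains (ν.size - μ.size) μ ν).ncard := by
  unfold numSkewTableaux
  split_ifs with h
  · rfl
  · rw [eq_comm, Set.ncard_eq_zero (Set.finite_coe_iff.1 (finite_chains _ _ _)),
      Set.eq_empty_iff_forall_notMem]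
    exact fun T hT => h (diagram_subset_of_mem_chains hT)

/-- Removing the largest entry of a standard tableau of skew shape. -/
theorem numSkewTableaux_eq_sum {ν μ : StrictPartition} (h : μ.size < ν.size) :
    numSkewTableaux ν μ = ∑ κ ∈ predecessors ν, numSkewTableaux κ μ := by
  obtain ⟨k, hk⟩ := Nat.exists_eq_add_of_lt h
  rw [numSkewTableaux_eq_ncard_chains, show ν.size - μ.size = k + 1 by omega, ncard_chains_succ]
  refine Finset.sum_congr rfl fun κ hκ => ?_
  have := (mem_predecessors.1 hκ).size_eq
  rw [numSkewTableaux_eq_ncard_chains, show κ.size - μ.size = k by omega]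

theorem eq_empty_of_size_eq_zero {ν : StrictPartition} (h : ν.size = 0) : ν = empty := by
  refine toFinset_injective ?_
  change ν.toFinset = ∅
  rw [← sum_toFinset_id, Finset.sum_eq_zero_iff] at h
  refine Finset.eq_empty_of_forall_notMem fun a ha => ν.zero_notMem_toFinset ?_
  rwa [h a ha] at ha

theorem numTableaux_empty : empty.numTableaux = 1 := by
  rw [numTableaux, numSkewTableaux_eq_ncard_chains, Nat.sub_self, Set.ncard_eq_one]
  refine ⟨fun _ => empty, Set.ext fun T => ⟨fun hT => funext fun i => ?_, ?_⟩⟩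
  · rw [Fin.fin_one_eq_zero i]
    exact hT.1
  · rintro rfl
    exact ⟨rfl, rfl, fun i => i.elim0⟩

end StrictPartition

open StrictPartition

/-! ### Schur's product and the transition probabilities -/

/-- The factor by which `density` changes when the part `a` is added to the set `t`. -/
noncomputable def insertFactor (a : ℕ) (t : Finset ℕ) : ℚ :=
  (a.factorial : ℚ)⁻¹ * ∏ y ∈ t, |(a : ℚ) - y| / (a + y)

/-- Schur's product `∏ 1 / x! · ∏ (x - y) / (x + y)` over the parts `x`, respectively over the
pairs `x > y` of parts. -/
noncomputable def density (s : Finset ℕ) : ℚ :=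
  ∏ x ∈ s, ((x.factorial : ℚ)⁻¹ * ∏ y ∈ s with y < x, ((x : ℚ) - y) / (x + y))

theorem density_insert {a : ℕ} {t : Finset ℕ} (ha : a ∉ t) :
    density (insert a t) = density t * insertFactor a t := by
  have h1 : ∀ x ∈ t, (∏ y ∈ insert a t with y < x, ((x : ℚ) - y) / (x + y)) =
      (∏ y ∈ t with y < x, ((x : ℚ) - y) / (x + y)) *
        if a < x then ((x : ℚ) - a) / (x + a) else 1 := by
    intro x _
    rw [Finset.filter_insert]
    split_ifs with h
    · rw [Finset.prod_insert (by simp [ha]), mul_comm]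
    · rw [mul_one]
  have h2 : (∏ y ∈ insert a t with y < a, ((a : ℚ) - y) / (a + y)) =
      ∏ y ∈ t, if y < a then ((a : ℚ) - y) / (a + y) else 1 := by
    rw [Finset.filter_insert, if_neg (lt_irrefl a), Finset.prod_filter]
  have h3 : ∀ y ∈ t, |(a : ℚ) - y| / (a + y) =
      (if y < a then ((a : ℚ) - y) / (a + y) else 1) *
        if a < y then ((y : ℚ) - a) / (y + a) else 1 := by
    intro y hy
    rcases lt_trichotomy y a with h | rfl | h
    · have : (y : ℚ) < a := by exact_mod_cast h
      rw [if_pos h, if_neg h.le.not_gt, mul_one, abs_of_pos (by linarith)]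
    · exact absurd hy ha
    · have : (a : ℚ) < y := by exact_mod_cast h
      rw [if_neg h.le.not_gt, if_pos h, one_mul, abs_of_neg (by linarith), neg_sub,
        add_comm (a : ℚ)]
  simp only [density, insertFactor, Finset.prod_insert ha, h2, Finset.prod_mul_distrib,
    Finset.prod_congr rfl h1, Finset.prod_congr rfl h3]
  ring

theorem density_pos (s : Finset ℕ) : 0 < density s := by
  refine Finset.prod_pos fun x _ => mul_pos (by positivity) (Finset.prod_pos fun y hy => ?_)
  have : (y : ℚ) < x := by exact_mod_cast (Finset.mem_filter.1 hy).2
  exact div_pos (by linarith) (by linarith [y.cast_nonneg (α := ℚ)])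

theorem insertFactor_zero {t : Finset ℕ} (ht : 0 ∉ t) : insertFactor 0 t = 1 := by
  rw [insertFactor, Finset.prod_eq_one]
  · simp
  · intro y hy
    have : (y : ℚ) ≠ 0 := by
      rw [Nat.cast_ne_zero]
      rintro rfl
      exact ht hy
    simp [this]

/-- Both products are over differences of the numbers `z (z + 1)`; the common sign of the factors
makes the absolute values disappear. -/
theorem insertFactor_succ {t : Finset ℕ} (ht : 0 ∉ t) (x : ℕ) :
    insertFactor (x + 1) t * ((x + 1) * ∏ y ∈ t, ((x : ℚ) * (x + 1) - y * (y + 1))) =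
      insertFactor x t * ∏ y ∈ t, ((x : ℚ) * (x + 1) - y * (y - 1)) := by
  have h : ∀ y ∈ t, |((x + 1 : ℕ) : ℚ) - y| / ((x + 1 : ℕ) + y) *
      ((x : ℚ) * (x + 1) - y * (y + 1)) =
      |(x : ℚ) - y| / (x + y) * ((x : ℚ) * (x + 1) - y * (y - 1)) := by
    intro y hy
    have hy0 : 0 < y := Nat.pos_of_ne_zero fun h => ht (h ▸ hy)
    have h1 : (0 : ℚ) < (x : ℚ) + y := by positivity
    push_cast
    have h2 : (x : ℚ) * (x + 1) - y * (y + 1) = (x - y) * (x + 1 + y) := by ring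
    have h3 : (x : ℚ) * (x + 1) - y * (y - 1) = (x + 1 - y) * (x + y) := by ring
    have h4 : |(x : ℚ) + 1 - y| * (x - y) = |(x : ℚ) - y| * (x + 1 - y) := by
      rcases lt_or_ge x y with h | h
      · have : (x : ℚ) + 1 ≤ y := by exact_mod_cast h
        rw [abs_of_nonpos (by linarith), abs_of_nonpos (by linarith)]
        ring
      · have : (y : ℚ) ≤ x := by exact_mod_cast h
        rw [abs_of_nonneg (by linarith), abs_of_nonneg (by linarith)]
        ring
    rw [h2, h3, div_mul_eq_mul_div, div_mul_eq_mul_div, div_eq_div_iff (by positivity) h1.ne']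
    linear_combination ((x : ℚ) + 1 + y) * (x + y) * h4
  have h' := Finset.prod_congr rfl h
  rw [Finset.prod_mul_distrib, Finset.prod_mul_distrib] at h'
  have hx : ((x + 1).factorial : ℚ)⁻¹ * (x + 1) = (x.factorial : ℚ)⁻¹ := by
    rw [Nat.factorial_succ]
    push_cast
    field_simp
  unfold insertFactor
  rw [← hx]
  linear_combination ((x + 1).factorial : ℚ)⁻¹ * (x + 1) * h'

/-- Adding the part zero changes nothing, so that lengthening a row and creating a row of length
one need not be distinguished here. -/
theorem density_eq_erase {s : Finset ℕ} (hs : 0 ∉ s) {x : ℕ} (hx : x = 0 ∨ x ∈ s) :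
    density s = density (s.erase x) * insertFactor x (s.erase x) := by
  by_cases h : x ∈ s
  · rw [← density_insert (Finset.notMem_erase _ _), Finset.insert_erase h]
  · obtain rfl := hx.resolve_right h
    rw [Finset.erase_eq_of_notMem h, insertFactor_zero hs, mul_one]

/-- The probability of lengthening the row of length `x` in the Plancherel growth process, when `s`
is the set of parts; for `x = 0`, of creating a row of length one. -/
noncomputable def transition (s : Finset ℕ) (x : ℕ) : ℚ :=
  (∏ y ∈ s, ((x : ℚ) * (x + 1) - y * (y - 1))) /
    ∏ y ∈ (insert 0 s).erase x, ((x : ℚ) * (x + 1) - y * (y + 1))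

theorem mul_succ_injective {x y : ℕ} (h : (x : ℚ) * (x + 1) = y * (y + 1)) : x = y := by
  have h' : x * (x + 1) = y * (y + 1) := by exact_mod_cast h
  nlinarith [lt_trichotomy x y]

/-- The formula gives weight zero to the rows that cannot be lengthened. -/
theorem transition_eq_zero {s : Finset ℕ} {x : ℕ} (hx : x + 1 ∈ s) : transition s x = 0 := by
  rw [transition, Finset.prod_eq_zero hx, zero_div]
  push_cast
  ring

/-- The transition probability as a quotient of densities. The exponent is `1` if a row is
lengthened and `0` if a row is created. -/
theorem transition_eq_density {s : Finset ℕ} (hs : 0 ∉ s) {x : ℕ} (hx : x ∈ addable s) :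
    transition s x * density s =
      2 ^ (1 + (s.card : ℤ) - (moveUp s x).card) * density (moveUp s x) := by
  obtain ⟨h0, h1⟩ := mem_addable.1 hx
  have ht : 0 ∉ s.erase x := fun h => hs (Finset.mem_of_mem_erase h)
  have h1' : x + 1 ∉ s.erase x := fun h => h1 (Finset.mem_of_mem_erase h)
  have key := insertFactor_succ ht x
  have hne : ∏ y ∈ s.erase x, ((x : ℚ) * (x + 1) - y * (y + 1)) ≠ 0 :=
    Finset.prod_ne_zero_iff.2 fun y hy h =>
      Finset.ne_of_mem_erase hy (mul_succ_injective (sub_eq_zero.1 h)).symm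
  rw [density_eq_erase hs h0, moveUp, density_insert h1', Finset.card_insert_of_notMem h1',
    transition]
  by_cases h : x ∈ s
  · have hx0 : x ≠ 0 := fun h' => hs (h' ▸ h)
    have hxq : (x : ℚ) ≠ 0 := Nat.cast_ne_zero.2 hx0
    rw [Finset.card_erase_add_one h, Finset.erase_insert_of_ne hx0.symm,
      Finset.prod_insert ht, ← Finset.mul_prod_erase s _ h, add_sub_cancel_right, zpow_one]
    push_cast
    rw [div_mul_eq_mul_div, div_eq_iff (by
      refine mul_ne_zero ?_ hne
      have : (0 : ℚ) < x * (x + 1) := by positivity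
      simpa using this.ne')]
    linear_combination (-2 * (x : ℚ) * density (s.erase x)) * key
  · obtain rfl := h0.resolve_right h
    rw [Finset.erase_insert hs]
    rw [Finset.erase_eq_of_notMem h] at key hne ⊢
    rw [show (1 : ℤ) + s.card - (s.card + 1 : ℕ) = 0 by push_cast; ring, zpow_zero,
      div_mul_eq_mul_div, div_eq_iff hne]
    push_cast at key ⊢
    linear_combination (-density s) * key

/-! ### The number of shifted standard tableaux -/

/-- The residue of `∏ (z - y (y + 1)) / (z - y (y - 1))` at `z = x (x - 1)` is `-2` times the
summand, and the sum of the residues is read off at infinity. -/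
theorem sum_residues {s : Finset ℕ} (hs : 0 ∉ s) :
    ∑ x ∈ s, (x : ℚ) * ((∏ y ∈ s.erase x, ((x : ℚ) * (x - 1) - y * (y + 1))) /
      ∏ y ∈ s.erase x, ((x : ℚ) * (x - 1) - y * (y - 1))) = ∑ x ∈ s, (x : ℚ) := by
  open Polynomial in
  rcases s.eq_empty_or_nonempty with rfl | hne
  · simp
  have hcard := hne.card_pos
  set P : ℚ[X] := ∏ y ∈ s, (X - C ((y : ℚ) * (y + 1))) with hP
  set Q : ℚ[X] := ∏ y ∈ s, (X - C ((y : ℚ) * (y - 1))) with hQ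
  have hinj : Set.InjOn (fun y : ℕ => (y : ℚ) * (y - 1)) s := by
    intro x hx y hy h
    obtain ⟨x, rfl⟩ := Nat.exists_eq_succ_of_ne_zero fun h' : x = 0 => hs (h' ▸ hx)
    obtain ⟨y, rfl⟩ := Nat.exists_eq_succ_of_ne_zero fun h' : y = 0 => hs (h' ▸ hy)
    rw [mul_succ_injective (x := x) (y := y)]
    simp only [Nat.succ_eq_add_one, Nat.cast_add, Nat.cast_one, add_sub_cancel_right] at h
    linarith
  have hdeg : (P - Q).degree < s.card := by
    have hPd : P.degree = s.card := Lagrange.degree_nodal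
    have hQd : Q.degree = s.card := Lagrange.degree_nodal
    rw [← hPd]
    refine degree_sub_lt_left (hPd.trans hQd.symm) ?_ ?_
    · exact (monic_prod_X_sub_C _ _).ne_zero
    · rw [(monic_prod_X_sub_C _ _).leadingCoeff, (monic_prod_X_sub_C _ _).leadingCoeff]
  have key := Lagrange.coeff_eq_sum hinj hdeg
  rw [coeff_sub, hP, hQ, prod_X_sub_C_coeff_card_pred _ _ hcard,
    prod_X_sub_C_coeff_card_pred _ _ hcard] at key
  have hev : ∀ x ∈ s, (P - Q).eval ((x : ℚ) * (x - 1)) =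
      -2 * x * ∏ y ∈ s.erase x, ((x : ℚ) * (x - 1) - y * (y + 1)) := by
    intro x hx
    have hQ0 : Q.eval ((x : ℚ) * (x - 1)) = 0 := by
      rw [hQ, eval_prod, Finset.prod_eq_zero hx (by simp)]
    rw [eval_sub, hQ0, hP, eval_prod, ← Finset.mul_prod_erase s _ hx]
    simp only [eval_sub, eval_X, eval_C]
    ring
  rw [← hP, ← hQ] at key
  have h2 : ∑ x ∈ s, (x : ℚ) * (x - 1) - ∑ x ∈ s, (x : ℚ) * (x + 1) = -2 * ∑ x ∈ s, (x : ℚ) := by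
    rw [← Finset.sum_sub_distrib, Finset.mul_sum]
    exact Finset.sum_congr rfl fun x _ => by ring
  have h3 : -2 * ∑ x ∈ s, (x : ℚ) * ((∏ y ∈ s.erase x, ((x : ℚ) * (x - 1) - y * (y + 1))) /
      ∏ y ∈ s.erase x, ((x : ℚ) * (x - 1) - y * (y - 1))) = -2 * ∑ x ∈ s, (x : ℚ) := by
    rw [← h2, Finset.mul_sum]
    refine Eq.trans (Finset.sum_congr rfl fun x hx => ?_) (key.symm.trans (by abel))
    rw [hev x hx]
    ring
  linarith

/-- The set of parts after a box is removed from the row of length `x`. -/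
def moveDown (s : Finset ℕ) (x : ℕ) : Finset ℕ := (insert (x - 1) (s.erase x)).erase 0

theorem density_moveDown {s : Finset ℕ} (hs : 0 ∉ s) {x : ℕ} (hx : x ∈ s) (hx' : x - 1 ∉ s) :
    density (moveDown s x) =
      (x : ℚ) * ((∏ y ∈ s.erase x, ((x : ℚ) * (x - 1) - y * (y + 1))) /
        ∏ y ∈ s.erase x, ((x : ℚ) * (x - 1) - y * (y - 1))) * density s := by
  obtain ⟨x, rfl⟩ := Nat.exists_eq_succ_of_ne_zero fun h' : x = 0 => hs (h' ▸ hx)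
  rw [Nat.succ_eq_add_one, Nat.add_sub_cancel] at *
  have ht : 0 ∉ s.erase (x + 1) := fun h => hs (Finset.mem_of_mem_erase h)
  have hxt : x ∉ s.erase (x + 1) := fun h => hx' (Finset.mem_of_mem_erase h)
  have key := insertFactor_succ ht x
  have hD : density (moveDown s (x + 1)) =
      density (s.erase (x + 1)) * insertFactor x (s.erase (x + 1)) := by
    rw [moveDown, Nat.add_sub_cancel]
    rcases eq_or_ne x 0 with rfl | h0
    · rw [Finset.erase_insert ht, insertFactor_zero ht, mul_one]
    · rw [Finset.erase_insert_of_ne h0, Finset.erase_eq_of_notMem ht, density_insert hxt]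
  have hne : ∏ y ∈ s.erase (x + 1), ((x : ℚ) * (x + 1) - y * (y - 1)) ≠ 0 := by
    refine Finset.prod_ne_zero_iff.2 fun y hy h => ?_
    obtain ⟨y, rfl⟩ := Nat.exists_eq_succ_of_ne_zero fun h' : y = 0 => ht (h' ▸ hy)
    push_cast at h
    rw [mul_succ_injective (x := x) (y := y) (by linarith)] at hy
    exact Finset.ne_of_mem_erase hy rfl
  have hc : ((x + 1 : ℕ) : ℚ) * ((x + 1 : ℕ) - 1) = x * (x + 1) := by push_cast; ring
  rw [hD, density_eq_erase hs (Or.inr hx), hc, mul_div_assoc', div_mul_eq_mul_div,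
    eq_div_iff hne]
  push_cast
  linear_combination (-density (s.erase (x + 1))) * key

/-- Sums over the strict partitions covered by `ν` are sums over the rows that can be shortened. -/
theorem sum_predecessors {M : Type*} [AddCommMonoid M] (ν : StrictPartition)
    (F : Finset ℕ → M) :
    ∑ κ ∈ predecessors ν, F κ.toFinset =
      ∑ x ∈ ν.toFinset with x - 1 ∉ ν.toFinset, F (moveDown ν.toFinset x) := by
  have hs := ν.zero_notMem_toFinset
  set s := ν.toFinset with hsdef
  have hsucc : ∀ {x}, x ∈ s → ∃ y, x = y + 1 := fun {x} hx =>
    Nat.exists_eq_succ_of_ne_zero fun h' : x = 0 => hs (h' ▸ hx)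
  have h0 : ∀ x, 0 ∉ moveDown s x := fun x => Finset.notMem_erase _ _
  symm
  refine Finset.sum_bij (fun x _ => ofFinset (moveDown s x)) ?_ ?_ ?_ ?_
  · intro x hx
    obtain ⟨hx, hx'⟩ := Finset.mem_filter.1 hx
    obtain ⟨y, rfl⟩ := hsucc hx
    rw [Nat.add_sub_cancel] at hx'
    rw [mem_predecessors, addsOneBox_iff, toFinset_ofFinset (h0 _), ← hsdef]
    refine ⟨y, mem_addable.2 ⟨?_, ?_⟩, ?_⟩
    · rcases eq_or_ne y 0 with h | h
      · exact Or.inl h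
      · exact Or.inr (by simp [moveDown, h])
    · simp [moveDown]
    · ext a
      simp only [moveUp, moveDown, Finset.mem_insert, Finset.mem_erase, Nat.add_sub_cancel]
      by_cases ha : a = y + 1
      · simp [ha, hx]
      · by_cases ha' : a = y
        · simp [ha', hx']
        · have : a ∈ s → a ≠ 0 := fun h h' => hs (h' ▸ h)
          tauto
  · intro x hx y hy h
    obtain ⟨hx, hx'⟩ := Finset.mem_filter.1 hx
    obtain ⟨hy, hy'⟩ := Finset.mem_filter.1 hy
    have h := congrArg toFinset h
    rw [toFinset_ofFinset (h0 _), toFinset_ofFinset (h0 _)] at h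
    by_contra hxy
    have hmem : x ∈ moveDown s y :=
      Finset.mem_erase.2 ⟨fun h' => hs (h' ▸ hx),
        Finset.mem_insert_of_mem (Finset.mem_erase.2 ⟨hxy, hx⟩)⟩
    rw [← h] at hmem
    obtain ⟨y, rfl⟩ := hsucc hx
    simp [moveDown] at hmem
  · intro κ hκ
    obtain ⟨x, hx, h⟩ := addsOneBox_iff.1 (mem_predecessors.1 hκ)
    rw [← hsdef] at h
    obtain ⟨hx0, hx1⟩ := mem_addable.1 hx
    have hxs : x + 1 ∈ s := h ▸ Finset.mem_insert_self _ _
    refine ⟨x + 1, Finset.mem_filter.2 ⟨hxs, ?_⟩, toFinset_injective ?_⟩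
    · rw [h]
      simp [moveUp]
    · rw [toFinset_ofFinset (h0 _), moveDown, Nat.add_sub_cancel, h, moveUp,
        Finset.erase_insert fun h => hx1 (Finset.mem_of_mem_erase h)]
      have hκ0 := κ.zero_notMem_toFinset
      rcases hx0 with rfl | hx0
      · rw [Finset.erase_eq_of_notMem hκ0, Finset.erase_insert hκ0]
      · rw [Finset.insert_erase hx0, Finset.erase_eq_of_notMem hκ0]
  · intro x _
    rw [toFinset_ofFinset (h0 _)]

/-- Schur's product formula for the number of shifted standard tableaux. -/
theorem numTableaux_eq (ν : StrictPartition) :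
    (ν.numTableaux : ℚ) = ν.size.factorial * density ν.toFinset := by
  induction hn : ν.size generalizing ν with
  | zero =>
    rw [eq_empty_of_size_eq_zero hn, numTableaux_empty]
    simp [density, toFinset, empty]
  | succ n ih =>
    have hs := ν.zero_notMem_toFinset
    have h1 : ν.numTableaux = ∑ κ ∈ predecessors ν, κ.numTableaux :=
      numSkewTableaux_eq_sum (by rw [hn]; exact Nat.succ_pos n)
    rw [h1, Nat.cast_sum, Finset.sum_congr rfl fun κ hκ => ih κ (by
      have := (mem_predecessors.1 hκ).size_eq
      omega), ← Finset.mul_sum, sum_predecessors ν density]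
    have hsize : ∑ x ∈ ν.toFinset, (x : ℚ) = n + 1 := by
      rw [← Nat.cast_sum, sum_toFinset_id, hn]
      push_cast
      ring
    rw [Finset.sum_congr rfl fun x hx =>
      density_moveDown hs (Finset.mem_filter.1 hx).1 (Finset.mem_filter.1 hx).2,
      Finset.sum_filter_of_ne, ← Finset.sum_mul, sum_residues hs, hsize, Nat.factorial_succ]
    · push_cast
      ring
    · -- the summands in which a row cannot be shortened vanish
      intro x hx h hx'
      have hx0 : x ≠ 0 := fun h' => hs (h' ▸ hx)
      refine h ?_
      rw [Finset.prod_eq_zero (Finset.mem_erase.2 ⟨by omega, hx'⟩), zero_div, mul_zero, zero_mul]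
      rw [Nat.cast_pred (Nat.pos_of_ne_zero hx0)]
      ring

/-! ### The moments of the transition probabilities -/

/-- The geometric series `1 / (1 - c X)`. -/
noncomputable def geomSeries (c : ℚ) : PowerSeries ℚ := PowerSeries.mk fun n => c ^ n

theorem one_sub_mul_geomSeries (c : ℚ) :
    (1 - PowerSeries.C c * PowerSeries.X) * geomSeries c = 1 := by
  ext n
  rw [sub_mul, one_mul, map_sub, mul_assoc, PowerSeries.coeff_C_mul]
  cases n with
  | zero => simp [geomSeries]
  | succ n =>
    rw [PowerSeries.coeff_succ_X_mul, PowerSeries.coeff_one, if_neg (Nat.succ_ne_zero n)]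
    simp [geomSeries, pow_succ']

theorem derivative_geomSeries (c : ℚ) :
    PowerSeries.derivative ℚ (geomSeries c) = PowerSeries.C c * geomSeries c ^ 2 := by
  have h := congrArg (PowerSeries.derivative ℚ) (one_sub_mul_geomSeries c)
  rw [Derivation.leibniz, PowerSeries.derivative_one, map_sub, PowerSeries.derivative_one,
    Derivation.leibniz, PowerSeries.derivative_X, PowerSeries.derivative_C] at h
  simp only [smul_eq_mul] at h
  linear_combination geomSeries c * h -
    (PowerSeries.derivative ℚ (geomSeries c)) * one_sub_mul_geomSeries c

/-- The product `∏ (1 - y (y - 1) X) / (1 - y (y + 1) X)`. -/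
noncomputable def momentSeries (s : Finset ℕ) : PowerSeries ℚ :=
  ∏ y ∈ s, ((1 - PowerSeries.C ((y : ℚ) * (y - 1)) * PowerSeries.X) *
    geomSeries ((y : ℚ) * (y + 1)))

/-- The coefficients of `X` times the logarithmic derivative of `momentSeries`. -/
def momentLog (s : Finset ℕ) (j : ℕ) : ℚ :=
  ∑ y ∈ s, (((y : ℚ) * (y + 1)) ^ j - ((y : ℚ) * (y - 1)) ^ j)

theorem X_mul_derivative_momentSeries (s : Finset ℕ) :
    PowerSeries.X * PowerSeries.derivative ℚ (momentSeries s) =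
      momentSeries s * PowerSeries.mk (momentLog s) := by
  induction s using Finset.induction_on with
  | empty =>
    have : PowerSeries.mk (momentLog ∅) = (0 : PowerSeries ℚ) := by
      ext
      simp [momentLog]
    rw [this, momentSeries, Finset.prod_empty, PowerSeries.derivative_one, mul_zero, mul_zero]
  | insert y s hy ih =>
    have hlog : PowerSeries.mk (momentLog (insert y s)) =
        geomSeries ((y : ℚ) * (y + 1)) - geomSeries ((y : ℚ) * (y - 1)) +
          PowerSeries.mk (momentLog s) := by
      ext
      simp [momentLog, geomSeries, Finset.sum_insert hy]
    have hprod : momentSeries (insert y s) =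
        ((1 - PowerSeries.C ((y : ℚ) * (y - 1)) * PowerSeries.X) *
          geomSeries ((y : ℚ) * (y + 1))) * momentSeries s := by
      rw [momentSeries, Finset.prod_insert hy, momentSeries]
    rw [hlog, hprod]
    generalize (y : ℚ) * (y + 1) = a
    generalize (y : ℚ) * (y - 1) = b
    have ha := one_sub_mul_geomSeries a
    have hb := one_sub_mul_geomSeries b
    rw [Derivation.leibniz, Derivation.leibniz, map_sub, PowerSeries.derivative_one,
      Derivation.leibniz, PowerSeries.derivative_X, PowerSeries.derivative_C,
      derivative_geomSeries]
    simp only [smul_eq_mul]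
    linear_combination (1 - PowerSeries.C b * PowerSeries.X) * geomSeries a * ih -
      momentSeries s * geomSeries a * ha + momentSeries s * geomSeries a * hb +
      momentSeries s * PowerSeries.C b * PowerSeries.X * geomSeries a * ha

/-- Newton's identities for the coefficients of `momentSeries`. -/
theorem mul_coeff_momentSeries (s : Finset ℕ) (j : ℕ) :
    (j : ℚ) * PowerSeries.coeff j (momentSeries s) =
      ∑ i ∈ Finset.range j, PowerSeries.coeff i (momentSeries s) * momentLog s (j - i) := by
  have h := congrArg (PowerSeries.coeff j) (X_mul_derivative_momentSeries s)
  have h0 : momentLog s 0 = 0 := by simp [momentLog]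
  rw [PowerSeries.coeff_mul (n := j) (φ := momentSeries s),
    Finset.Nat.sum_antidiagonal_eq_sum_range_succ_mk, Finset.sum_range_succ] at h
  simp only [PowerSeries.coeff_mk, Nat.sub_self, h0, mul_zero, add_zero] at h
  rw [← h]
  cases j with
  | zero => simp
  | succ j =>
    rw [PowerSeries.coeff_succ_X_mul, PowerSeries.coeff_derivative]
    push_cast
    ring

theorem reflect_prod_X_sub_C {ι : Type*} [DecidableEq ι] (s : Finset ι) (v : ι → ℚ) :
    (∏ i ∈ s, (Polynomial.X - Polynomial.C (v i))).reflect s.card =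
      ∏ i ∈ s, (1 - Polynomial.C (v i) * Polynomial.X) := by
  induction s using Finset.induction_on with
  | empty => simp
  | insert i s hi ih =>
    rw [Finset.prod_insert hi, Finset.prod_insert hi, Finset.card_insert_of_notMem hi, add_comm,
      Polynomial.reflect_mul _ _ (Polynomial.natDegree_X_sub_C_le _)
        (Polynomial.natDegree_finsetProd_X_sub_C_eq_card s v).le, ih]
    congr 1
    rw [sub_eq_add_neg, Polynomial.reflect_add, Polynomial.reflect_neg, Polynomial.reflect_C,
      pow_one, Polynomial.reflect_one_X, sub_eq_add_neg]

/-- Lagrange interpolation, in the form of a partial fraction expansion cleared of denominators. -/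
theorem prod_eq_sum_transition {s : Finset ℕ} (hs : 0 ∉ s) :
    ∏ y ∈ s, (Polynomial.X - Polynomial.C ((y : ℚ) * (y - 1))) =
      ∑ x ∈ insert 0 s, Polynomial.C (transition s x) *
        ∏ y ∈ (insert 0 s).erase x, (Polynomial.X - Polynomial.C ((y : ℚ) * (y + 1))) := by
  have hinj : Set.InjOn (fun y : ℕ => (y : ℚ) * (y + 1)) (insert 0 s : Finset ℕ) :=
    fun x _ y _ h => mul_succ_injective h
  have hdeg : (∏ y ∈ s, (Polynomial.X - Polynomial.C ((y : ℚ) * (y - 1)))).degree <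
      ((insert 0 s).card : WithBot ℕ) := by
    rw [Finset.card_insert_of_notMem hs]
    refine lt_of_eq_of_lt (Lagrange.degree_nodal (s := s) (v := fun y : ℕ => (y : ℚ) * (y - 1))) ?_
    exact_mod_cast Nat.lt_succ_self _
  rw [Lagrange.eq_interpolate hinj hdeg, Lagrange.interpolate_eq_sum]
  refine Finset.sum_congr rfl fun x _ => ?_
  rw [transition, Polynomial.eval_prod]
  simp

/-- The partial fraction expansion of the generating function of the moments. -/
theorem momentSeries_eq_sum {s : Finset ℕ} (hs : 0 ∉ s) :
    momentSeries s =
      ∑ x ∈ insert 0 s, PowerSeries.C (transition s x) * geomSeries ((x : ℚ) * (x + 1)) := by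
  have h := congrArg (Polynomial.reflect s.card) (prod_eq_sum_transition hs)
  have hsum : ∀ F : ℕ → Polynomial ℚ, (∑ x ∈ insert 0 s, F x).reflect s.card =
      ∑ x ∈ insert 0 s, (F x).reflect s.card := fun F => by
    ext n
    simp [Polynomial.finsetSum_coeff, Polynomial.coeff_reflect]
  have hterm : ∀ x ∈ insert 0 s, (Polynomial.C (transition s x) *
      ∏ y ∈ (insert 0 s).erase x, (Polynomial.X - Polynomial.C ((y : ℚ) * (y + 1)))).reflect
        s.card = Polynomial.C (transition s x) *
      ∏ y ∈ (insert 0 s).erase x, (1 - Polynomial.C ((y : ℚ) * (y + 1)) * Polynomial.X) := by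
    intro x hx
    have hcard : ((insert 0 s).erase x).card = s.card := by
      rw [Finset.card_erase_of_mem hx, Finset.card_insert_of_notMem hs, Nat.add_sub_cancel]
    rw [Polynomial.reflect_C_mul, ← hcard, reflect_prod_X_sub_C]
  rw [reflect_prod_X_sub_C, hsum, Finset.sum_congr rfl hterm] at h
  have h := congrArg (Polynomial.coeToPowerSeries.ringHom (R := ℚ)) h
  have hlin : ∀ c : ℚ, Polynomial.coeToPowerSeries.ringHom
      (1 - Polynomial.C c * Polynomial.X) = 1 - PowerSeries.C c * PowerSeries.X := fun c => by
    simp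
  have hmul : ∀ (c : ℚ) (p : Polynomial ℚ), Polynomial.coeToPowerSeries.ringHom
      (Polynomial.C c * p) = PowerSeries.C c * Polynomial.coeToPowerSeries.ringHom p :=
    fun c p => by simp
  simp only [map_sum, map_prod, hmul, hlin] at h
  -- the node `0` contributes the geometric series of ratio zero
  have hG : ∏ y ∈ s, geomSeries ((y : ℚ) * (y + 1)) =
      ∏ y ∈ insert 0 s, geomSeries ((y : ℚ) * (y + 1)) := by
    have h0 := one_sub_mul_geomSeries 0
    rw [map_zero, zero_mul, sub_zero, one_mul] at h0
    rw [Finset.prod_insert hs, Nat.cast_zero, zero_mul, h0, one_mul]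
  rw [momentSeries, Finset.prod_mul_distrib, h, hG, Finset.sum_mul]
  refine Finset.sum_congr rfl fun x hx => ?_
  rw [← Finset.mul_prod_erase _ _ hx, mul_assoc, mul_left_comm (∏ _ ∈ _, _),
    ← Finset.prod_mul_distrib, Finset.prod_eq_one fun y _ => one_sub_mul_geomSeries _, mul_one]

/-- The coefficients of `momentSeries` are the moments of the transition probabilities. -/
theorem coeff_momentSeries {s : Finset ℕ} (hs : 0 ∉ s) (j : ℕ) :
    PowerSeries.coeff j (momentSeries s) =
      ∑ x ∈ insert 0 s, transition s x * ((x : ℚ) * (x + 1)) ^ j := by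
  rw [momentSeries_eq_sum hs, map_sum]
  refine Finset.sum_congr rfl fun x _ => ?_
  rw [PowerSeries.coeff_C_mul, geomSeries, PowerSeries.coeff_mk]

/-! ### The degree of polynomials in the odd power sums -/

/-- The odd power sum `p_{2k+1}` of the parts. -/
def oddPowerSum (k : ℕ) (s : Finset ℕ) : ℚ := ∑ y ∈ s, (y : ℚ) ^ (2 * k + 1)

/-- The functions of the set of parts that are polynomials in the odd power sums, filtered by the
degree in which `p_{2k+1}` has degree `k + 1`. -/
inductive HasDegreeLE : ℕ → (Finset ℕ → ℚ) → Prop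
  | const (d : ℕ) (c : ℚ) : HasDegreeLE d fun _ => c
  | oddPowerSum (k : ℕ) : HasDegreeLE (k + 1) (oddPowerSum k)
  | add {d : ℕ} {f g : Finset ℕ → ℚ} :
      HasDegreeLE d f → HasDegreeLE d g → HasDegreeLE d fun s => f s + g s
  | mul {d e : ℕ} {f g : Finset ℕ → ℚ} :
      HasDegreeLE d f → HasDegreeLE e g → HasDegreeLE (d + e) fun s => f s * g s

namespace HasDegreeLE

theorem mono {d e : ℕ} {f : Finset ℕ → ℚ} (hf : HasDegreeLE d f) (h : d ≤ e) :
    HasDegreeLE e f := by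
  have := hf.mul (const (e - d) 1)
  rwa [Nat.add_sub_cancel' h, funext fun s => mul_one (f s)] at this

theorem const_mul {d : ℕ} {f : Finset ℕ → ℚ} (c : ℚ) (hf : HasDegreeLE d f) :
    HasDegreeLE d fun s => c * f s := by
  simpa using (const 0 c).mul hf

theorem sum {ι : Type*} {d : ℕ} (t : Finset ι) {f : ι → Finset ℕ → ℚ}
    (hf : ∀ i ∈ t, HasDegreeLE d (f i)) : HasDegreeLE d fun s => ∑ i ∈ t, f i s := by
  classical
  induction t using Finset.induction_on with
  | empty => simpa using const d 0
  | insert i t hi ih =>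
    simp only [Finset.sum_insert hi]
    exact (hf i (Finset.mem_insert_self _ _)).add
      (ih fun j hj => hf j (Finset.mem_insert_of_mem hj))

end HasDegreeLE

/-- A sequence with a linear recursion of order two, whose coefficients are polynomials in `u` of
degrees one and two, has terms that are polynomials in `u` of the expected degrees. -/
theorem exists_polynomial_of_recursion {α : Type*} (u : α → ℚ) (T : ℕ → α → ℚ)
    (p₀ p₁ a b : Polynomial ℚ) (h₀ : p₀.natDegree ≤ 0) (h₁ : p₁.natDegree ≤ 1)
    (ha : a.natDegree ≤ 1) (hb : b.natDegree ≤ 2)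
    (hT₀ : ∀ x, T 0 x = p₀.eval (u x)) (hT₁ : ∀ x, T 1 x = p₁.eval (u x))
    (hT : ∀ k x, T (k + 2) x = a.eval (u x) * T (k + 1) x + b.eval (u x) * T k x) (k : ℕ) :
    ∃ p : Polynomial ℚ, p.natDegree ≤ k ∧ ∀ x, T k x = p.eval (u x) := by
  induction k using Nat.twoStepInduction with
  | zero => exact ⟨p₀, h₀, hT₀⟩
  | one => exact ⟨p₁, h₁, hT₁⟩
  | more k ih₁ ih₂ =>
    obtain ⟨p, hp, hp'⟩ := ih₁
    obtain ⟨q, hq, hq'⟩ := ih₂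
    refine ⟨a * q + b * p, ?_, fun x => ?_⟩
    · refine Polynomial.natDegree_add_le_of_degree_le ?_ ?_
      · exact Polynomial.natDegree_mul_le.trans (by omega)
      · exact Polynomial.natDegree_mul_le.trans (by omega)
    · rw [hT, hp', hq', Polynomial.eval_add, Polynomial.eval_mul, Polynomial.eval_mul]

/-- `(x + 1) ^ (2k + 1) - x ^ (2k + 1)` is invariant under `x ↦ -1 - x`, so it is a polynomial in
`x (x + 1)`. -/
theorem exists_polynomial_sub_odd_pow (k : ℕ) :
    ∃ p : Polynomial ℚ, p.natDegree ≤ k ∧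
      ∀ x : ℚ, (x + 1) ^ (2 * k + 1) - x ^ (2 * k + 1) = p.eval (x * (x + 1)) := by
  -- `(x + 1)²` and `x²` are the roots of `t² - (2u + 1) t + u²`, where `u = x (x + 1)`
  refine exists_polynomial_of_recursion (fun x : ℚ => x * (x + 1))
    (fun k x => (x + 1) ^ (2 * k + 1) - x ^ (2 * k + 1)) 1 (3 * .X + 1)
    (2 * .X + 1) (-.X ^ 2) ?_ ?_ ?_ ?_ ?_ ?_ ?_ k
  · compute_degree
  · compute_degree
  · compute_degree
  · compute_degree
  · intro x
    simp
  · intro x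
    simp
    ring
  · intro k x
    simp
    ring

/-- `(y² + y)ʲ - (y² - y)ʲ` is an odd polynomial in `y`, of degree less than `2j`. -/
theorem exists_polynomial_sub_pow (k : ℕ) :
    ∃ p : Polynomial ℚ, p.natDegree ≤ k ∧
      ∀ y : ℚ, (y * (y + 1)) ^ (k + 1) - (y * (y - 1)) ^ (k + 1) = y * p.eval (y ^ 2) := by
  -- `y² + y` and `y² - y` are the roots of `t² - 2 y² t + (y⁴ - y²)`
  have hb : ((-.X ^ 2 + .X : Polynomial ℚ)).natDegree ≤ 2 := by compute_degree
  have ha : ((2 * .X : Polynomial ℚ)).natDegree ≤ 1 := by compute_degree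
  induction k using Nat.twoStepInduction with
  | zero => exact ⟨2, by compute_degree, fun y => by simp; ring⟩
  | one => exact ⟨4 * .X, by compute_degree, fun y => by simp; ring⟩
  | more k ih₁ ih₂ =>
    obtain ⟨p, hp, hp'⟩ := ih₁
    obtain ⟨q, hq, hq'⟩ := ih₂
    refine ⟨2 * .X * q + (-.X ^ 2 + .X) * p, ?_, fun y => ?_⟩
    · refine Polynomial.natDegree_add_le_of_degree_le ?_ ?_
      · exact Polynomial.natDegree_mul_le.trans (by omega)
      · exact Polynomial.natDegree_mul_le.trans (by omega)
    · have h1 := hp' y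
      have h2 := hq' y
      simp only [Polynomial.eval_add, Polynomial.eval_mul, Polynomial.eval_neg,
        Polynomial.eval_pow, Polynomial.eval_X, Polynomial.eval_ofNat]
      linear_combination 2 * y ^ 2 * h2 + (y ^ 2 - y ^ 4) * h1

theorem hasDegreeLE_momentLog (j : ℕ) : HasDegreeLE j fun s => momentLog s j := by
  cases j with
  | zero => simpa [momentLog] using HasDegreeLE.const 0 0
  | succ j =>
    obtain ⟨p, hp, h⟩ := exists_polynomial_sub_pow j
    have : (fun s => momentLog s (j + 1)) =
        fun s => ∑ k ∈ Finset.range (j + 1), p.coeff k * oddPowerSum k s := by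
      funext s
      simp only [momentLog, oddPowerSum, Finset.mul_sum]
      rw [Finset.sum_comm]
      refine Finset.sum_congr rfl fun y _ => ?_
      rw [h, Polynomial.eval_eq_sum_range' (Nat.lt_succ_of_le hp), Finset.mul_sum]
      exact Finset.sum_congr rfl fun k _ => by ring
    rw [this]
    exact HasDegreeLE.sum _ fun k hk => .const_mul _
      ((HasDegreeLE.oddPowerSum k).mono (Finset.mem_range.1 hk))

theorem coeff_zero_momentSeries (s : Finset ℕ) :
    PowerSeries.coeff 0 (momentSeries s) = 1 := by
  simp [momentSeries, map_prod, geomSeries]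

theorem hasDegreeLE_coeff_momentSeries (j : ℕ) :
    HasDegreeLE j fun s => PowerSeries.coeff j (momentSeries s) := by
  induction j using Nat.strong_induction_on with
  | _ j ih =>
    rcases Nat.eq_zero_or_pos j with rfl | hj
    · simp only [coeff_zero_momentSeries]
      exact .const 0 1
    · have : (fun s => PowerSeries.coeff j (momentSeries s)) = fun s => (j : ℚ)⁻¹ *
          ∑ i ∈ Finset.range j, PowerSeries.coeff i (momentSeries s) * momentLog s (j - i) := by
        funext s
        rw [← mul_coeff_momentSeries, inv_mul_cancel_left₀ (by positivity)]
      rw [this]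
      refine .const_mul _ (.sum _ fun i hi => ?_)
      have hi := Finset.mem_range.1 hi
      exact ((ih i hi).mul (hasDegreeLE_momentLog (j - i))).mono (by omega)

/-! ### The growth operator lowers the degree -/

/-- The polynomials in a variable `u` over the functions of `HasDegreeLE`, of total degree less
than `d` when `u` has degree one; only the zero polynomial for `d = 0`. -/
inductive HasDegreeLT (d : ℕ) : (Finset ℕ → ℚ → ℚ) → Prop
  | zero : HasDegreeLT d fun _ _ => 0
  | monomial {i j : ℕ} {f : Finset ℕ → ℚ} :
      HasDegreeLE i f → i + j < d → HasDegreeLT d fun s u => f s * u ^ j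
  | add {F G : Finset ℕ → ℚ → ℚ} :
      HasDegreeLT d F → HasDegreeLT d G → HasDegreeLT d fun s u => F s u + G s u

namespace HasDegreeLT

theorem mono {d e : ℕ} {F : Finset ℕ → ℚ → ℚ} (hF : HasDegreeLT d F) (h : d ≤ e) :
    HasDegreeLT e F := by
  induction hF with
  | zero => exact .zero
  | monomial hf hij => exact .monomial hf (hij.trans_le h)
  | add _ _ ih₁ ih₂ => exact ih₁.add ih₂

theorem mul_left {d e j : ℕ} {f : Finset ℕ → ℚ} {F : Finset ℕ → ℚ → ℚ} (hf : HasDegreeLE e f)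
    (hF : HasDegreeLT d F) : HasDegreeLT (e + j + d) fun s u => f s * u ^ j * F s u := by
  induction hF with
  | zero => simpa using zero
  | @monomial i k g hg hij =>
    have := monomial (d := e + j + d) (j := j + k) (hf.mul hg) (by omega)
    convert this using 3
    ring
  | add _ _ ih₁ ih₂ => simpa only [mul_add] using ih₁.add ih₂

theorem mul {d e : ℕ} {F G : Finset ℕ → ℚ → ℚ} (hF : HasDegreeLT d F) (hG : HasDegreeLT e G) :
    HasDegreeLT (d + e) fun s u => F s u * G s u := by
  induction hF with
  | zero => simpa using zero
  | monomial hf hij => exact (mul_left hf hG).mono (by omega)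
  | add _ _ ih₁ ih₂ => simpa only [add_mul] using ih₁.add ih₂

theorem sum {ι : Type*} {d : ℕ} (t : Finset ι) {F : ι → Finset ℕ → ℚ → ℚ}
    (hF : ∀ i ∈ t, HasDegreeLT d (F i)) : HasDegreeLT d fun s u => ∑ i ∈ t, F i s u := by
  classical
  induction t using Finset.induction_on with
  | empty => simpa using zero
  | insert i t hi ih =>
    simp only [Finset.sum_insert hi]
    exact (hF i (Finset.mem_insert_self _ _)).add
      (ih fun j hj => hF j (Finset.mem_insert_of_mem hj))

end HasDegreeLT

/-- When a box is added to a row of length `x`, the increment of a function of degree at most `d`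
is a polynomial in `x (x + 1)`, of total degree less than `d`. -/
theorem HasDegreeLE.exists_increment {d : ℕ} {f : Finset ℕ → ℚ} (hf : HasDegreeLE d f) :
    ∃ F, HasDegreeLT d F ∧ ∀ s, ∀ x ∈ addable s,
      f (moveUp s x) = f s + F s ((x : ℚ) * (x + 1)) := by
  induction hf with
  | const d c => exact ⟨_, .zero, fun s x _ => (add_zero c).symm⟩
  | oddPowerSum k =>
    obtain ⟨p, hp, h⟩ := exists_polynomial_sub_odd_pow k
    refine ⟨_, .sum (Finset.range (k + 1)) (F := fun j _ u => p.coeff j * u ^ j) fun j hj =>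
      .monomial (.const 0 (p.coeff j)) (by simpa using hj), fun s x hx => ?_⟩
    rw [← Polynomial.eval_eq_sum_range' (Nat.lt_succ_of_le hp), ← h, ShiftedPlancherel.oddPowerSum,
      sum_moveUp hx (F := fun y => (y : ℚ) ^ (2 * k + 1)) (by simp)]
    push_cast
    rfl
  | @add d f g _ _ ih₁ ih₂ =>
    obtain ⟨F, hF, hF'⟩ := ih₁
    obtain ⟨G, hG, hG'⟩ := ih₂
    refine ⟨_, hF.add hG, fun s x hx => ?_⟩
    simp only [hF' s x hx, hG' s x hx]
    ring
  | @mul d e f g hf hg ih₁ ih₂ =>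
    obtain ⟨F, hF, hF'⟩ := ih₁
    obtain ⟨G, hG, hG'⟩ := ih₂
    refine ⟨_, ((HasDegreeLT.mul_left (j := 0) hf hG).add
      ((HasDegreeLT.mul_left (j := 0) hg hF).mono (by omega))).add (hF.mul hG), fun s x hx => ?_⟩
    simp only [hF' s x hx, hG' s x hx]
    ring

/-- Averaging over the transitions turns `u ^ j` into a moment, of degree at most `j`. -/
theorem HasDegreeLT.exists_average {d : ℕ} {F : Finset ℕ → ℚ → ℚ} (hF : HasDegreeLT d F) :
    ∃ h, HasDegreeLE (d - 1) h ∧ (d = 0 → ∀ s, h s = 0) ∧ ∀ s, 0 ∉ s →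
      ∑ x ∈ insert 0 s, transition s x * F s ((x : ℚ) * (x + 1)) = h s := by
  induction hF with
  | zero => exact ⟨_, .const _ 0, fun _ _ => rfl, fun s _ => by simp⟩
  | @monomial i j f hf hij =>
    refine ⟨_, (hf.mul (hasDegreeLE_coeff_momentSeries j)).mono (by omega), by omega,
      fun s hs => ?_⟩
    rw [coeff_momentSeries hs, Finset.mul_sum]
    exact Finset.sum_congr rfl fun x _ => by ring
  | add _ _ ih₁ ih₂ =>
    obtain ⟨h₁, a₁, b₁, c₁⟩ := ih₁
    obtain ⟨h₂, a₂, b₂, c₂⟩ := ih₂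
    refine ⟨_, a₁.add a₂, fun hd s => by rw [b₁ hd, b₂ hd, add_zero], fun s hs => ?_⟩
    simp only [mul_add (transition _ _), Finset.sum_add_distrib]
    rw [c₁ s hs, c₂ s hs]

/-- The expected value of `f` after one step of the Plancherel growth process. -/
noncomputable def growth (f : Finset ℕ → ℚ) (s : Finset ℕ) : ℚ :=
  ∑ x ∈ addable s, transition s x * f (moveUp s x)

theorem HasDegreeLE.exists_growth_eq {d : ℕ} {f : Finset ℕ → ℚ} (hf : HasDegreeLE d f) :
    ∃ h, HasDegreeLE (d - 1) h ∧ (d = 0 → ∀ s, h s = 0) ∧ ∀ s, 0 ∉ s →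
      growth f s = f s + h s := by
  obtain ⟨F, hF, hinc⟩ := hf.exists_increment
  obtain ⟨h, h₁, h₂, h₃⟩ := hF.exists_average
  refine ⟨h, h₁, h₂, fun s hs => ?_⟩
  -- the moment of order zero: the transition probabilities sum to one
  have hone : ∑ x ∈ insert 0 s, transition s x = 1 := by
    rw [← coeff_zero_momentSeries s, coeff_momentSeries hs]
    simp
  rw [← h₃ s hs, growth, Finset.sum_congr rfl fun x hx => by rw [hinc s x hx], addable,
    Finset.sum_filter_of_ne]
  · simp only [mul_add (transition _ _), Finset.sum_add_distrib, ← Finset.sum_mul, hone, one_mul]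
  · intro x _ hne hx
    exact hne (by rw [transition_eq_zero hx, zero_mul])

/-! ### Averages over the growth process -/

/-- Schur's product formula turns the weight into a quotient of densities, free of factorials. -/
theorem weight_eq (μ : StrictPartition) {n : ℕ} {ν : StrictPartition}
    (hν : ν.size = n + μ.size) :
    weight μ n ν = (2 : ℚ) ^ ((n : ℤ) - ν.length + μ.length) *
      (density ν.toFinset / density μ.toFinset) * ν.numSkewTableaux μ := by
  have h1 := (density_pos μ.toFinset).ne'
  have h2 : ((n + μ.size).factorial : ℚ) ≠ 0 := Nat.cast_ne_zero.2 (Nat.factorial_ne_zero _)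
  have h3 : (μ.size.factorial : ℚ) ≠ 0 := Nat.cast_ne_zero.2 (Nat.factorial_ne_zero _)
  rw [weight, numTableaux_eq, numTableaux_eq, hν]
  field_simp

/-- Sums over the strict partitions covering `κ` are sums over the rows that can be lengthened. -/
theorem sum_successors (κ : StrictPartition) {N : ℕ} (hκ : κ.size + 1 = N) (F : Finset ℕ → ℚ) :
    (∑ ν ∈ ofSize N, open Classical in if AddsOneBox κ ν then F ν.toFinset else 0) =
      ∑ x ∈ addable κ.toFinset, F (moveUp κ.toFinset x) := by
  classical
  have h0 := zero_notMem_moveUp κ.zero_notMem_toFinset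
  rw [← Finset.sum_filter]
  symm
  refine Finset.sum_bij (fun x _ => ofFinset (moveUp κ.toFinset x)) ?_ ?_ ?_ ?_
  · intro x hx
    have h : AddsOneBox κ (ofFinset (moveUp κ.toFinset x)) :=
      addsOneBox_iff.2 ⟨x, hx, toFinset_ofFinset (h0 x)⟩
    exact Finset.mem_filter.2 ⟨mem_ofSize.2 (h.size_eq.trans hκ), h⟩
  · intro x hx y hy h
    have h := congrArg toFinset h
    rw [toFinset_ofFinset (h0 _), toFinset_ofFinset (h0 _)] at h
    exact moveUp_injOn _ hx hy h
  · intro ν hν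
    obtain ⟨x, hx, h⟩ := addsOneBox_iff.1 (Finset.mem_filter.1 hν).2
    exact ⟨x, hx, toFinset_injective ((toFinset_ofFinset (h0 x)).trans h.symm)⟩
  · intro x _
    rw [toFinset_ofFinset (h0 x)]

/-- The Markov property: a further step of the growth process amounts to replacing `f` by its
expected value after one step. -/
theorem average_succ (μ : StrictPartition) (n : ℕ) (f : Finset ℕ → ℚ) :
    average μ (n + 1) (fun ν => f ν.toFinset) =
      average μ n fun ν => growth f ν.toFinset := by
  classical
  unfold average
  have hN : n + 1 + μ.size = n + μ.size + 1 := by ring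
  have hstep : ∀ ν ∈ ofSize (n + 1 + μ.size), weight μ (n + 1) ν * f ν.toFinset =
      ∑ κ ∈ ofSize (n + μ.size), if AddsOneBox κ ν then
        weight μ n κ * ((2 : ℚ) ^ (1 + (κ.toFinset.card : ℤ) - ν.toFinset.card) *
          density ν.toFinset / density κ.toFinset * f ν.toFinset) else 0 := by
    intro ν hν
    have hν := mem_ofSize.1 hν
    have hpred : predecessors ν = (ofSize (n + μ.size)).filter fun κ => AddsOneBox κ ν := by
      ext κ
      rw [mem_predecessors, Finset.mem_filter, mem_ofSize]
      refine ⟨fun h => ⟨?_, h⟩, And.right⟩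
      have := h.size_eq
      omega
    rw [← Finset.sum_filter, ← hpred, weight_eq μ hν, numSkewTableaux_eq_sum (by omega),
      Nat.cast_sum, Finset.mul_sum, Finset.sum_mul]
    refine Finset.sum_congr rfl fun κ hκ => ?_
    have hκ : κ.size = n + μ.size := by
      have := (mem_predecessors.1 hκ).size_eq
      omega
    have h1 := (density_pos κ.toFinset).ne'
    have h2 : (2 : ℚ) ^ (((n + 1 : ℕ) : ℤ) - ν.length + μ.length) =
        2 ^ ((n : ℤ) - κ.length + μ.length) * 2 ^ (1 + (κ.length : ℤ) - ν.length) := by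
      rw [← zpow_add₀ two_ne_zero]
      congr 1
      push_cast
      ring
    rw [weight_eq μ hκ, h2, card_toFinset, card_toFinset]
    field_simp
  rw [Finset.sum_congr rfl hstep, Finset.sum_comm]
  refine Finset.sum_congr rfl fun κ hκ => ?_
  have hκ := mem_ofSize.1 hκ
  rw [sum_successors κ (by omega) fun t => weight μ n κ *
    ((2 : ℚ) ^ (1 + (κ.toFinset.card : ℤ) - t.card) * density t / density κ.toFinset * f t),
    ← Finset.mul_sum]
  congr 1
  refine Finset.sum_congr rfl fun x hx => ?_
  rw [← transition_eq_density κ.zero_notMem_toFinset hx,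
    mul_div_cancel_right₀ _ (density_pos κ.toFinset).ne']

/-- Polynomials have polynomial antidifferences. -/
theorem exists_polynomial_sub_eq (p : Polynomial ℚ) :
    ∃ q : Polynomial ℚ, ∀ x : ℚ, q.eval (x + 1) - q.eval x = p.eval x := by
  induction p using Polynomial.induction_on' with
  | add p₁ p₂ ih₁ ih₂ =>
    obtain ⟨q₁, h₁⟩ := ih₁
    obtain ⟨q₂, h₂⟩ := ih₂
    refine ⟨q₁ + q₂, fun x => ?_⟩
    rw [Polynomial.eval_add, Polynomial.eval_add, Polynomial.eval_add, ← h₁, ← h₂]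
    ring
  | monomial k a =>
    refine ⟨Polynomial.C (a / (k + 1)) * Polynomial.bernoulli (k + 1), fun x => ?_⟩
    have h := Polynomial.bernoulli_eval_one_add (k + 1) x
    rw [Polynomial.eval_mul, Polynomial.eval_mul, Polynomial.eval_C, Polynomial.eval_C, add_comm x,
      h, Polynomial.eval_monomial, Nat.add_sub_cancel]
    push_cast
    field_simp
    ring

/-- The average of `f` over `n` steps is an antidifference, in `n`, of the average of a function of
smaller degree. -/
theorem HasDegreeLE.exists_polynomial_average (μ : StrictPartition) {d : ℕ} {f : Finset ℕ → ℚ}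
    (hf : HasDegreeLE d f) :
    ∃ p : Polynomial ℚ, ∀ n : ℕ, average μ n (fun ν => f ν.toFinset) = p.eval (n : ℚ) := by
  have hsucc : ∀ {d f}, HasDegreeLE d f → ∃ h, HasDegreeLE (d - 1) h ∧ (d = 0 → ∀ s, h s = 0) ∧
      ∀ n, average μ (n + 1) (fun ν => f ν.toFinset) =
        average μ n (fun ν => f ν.toFinset) + average μ n (fun ν => h ν.toFinset) := by
    intro d f hf
    obtain ⟨h, h₁, h₂, h₃⟩ := hf.exists_growth_eq
    refine ⟨h, h₁, h₂, fun n => ?_⟩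
    rw [average_succ]
    simp only [average, h₃ _ (zero_notMem_toFinset _), mul_add, Finset.sum_add_distrib]
  induction d generalizing f with
  | zero =>
    obtain ⟨h, -, h₂, h₃⟩ := hsucc hf
    refine ⟨Polynomial.C (average μ 0 fun ν => f ν.toFinset), fun n => ?_⟩
    rw [Polynomial.eval_C]
    induction n with
    | zero => rfl
    | succ n ih =>
      rw [h₃, ih]
      simp [average, h₂ rfl]
  | succ d ih =>
    obtain ⟨h, h₁, -, h₃⟩ := hsucc hf
    obtain ⟨p, hp⟩ := ih h₁
    obtain ⟨q, hq⟩ := exists_polynomial_sub_eq p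
    refine ⟨q + Polynomial.C ((average μ 0 fun ν => f ν.toFinset) - q.eval 0), fun n => ?_⟩
    rw [Polynomial.eval_add, Polynomial.eval_C]
    induction n with
    | zero => simp
    | succ n ih =>
      rw [h₃, ih, hp, ← hq]
      push_cast
      ring

/-! ### Supersymmetric functions -/

/-- On strict partitions, a supersymmetric function is a polynomial in the odd power sums of the set
of parts. -/
theorem exists_hasDegreeLE_evalAt {f : symmetricFunctions} (hf : f ∈ supersymmetricFunctions) :
    ∃ (d : ℕ) (g : Finset ℕ → ℚ), HasDegreeLE d g ∧ ∀ ν, evalAt f ν = g ν.toFinset := by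
  induction hf using Algebra.adjoin_induction with
  | mem f hf =>
    obtain ⟨k, rfl⟩ := hf
    refine ⟨k + 1, _, .oddPowerSum k, fun ν => ?_⟩
    change MvPolynomial.eval _ (MvPolynomial.psum (Fin ν.length) ℚ (2 * k + 1)) = _
    rw [oddPowerSum, sum_toFinset, ← List.sum_ofFn.symm.trans (congrArg List.sum
      (List.ofFn_getElem_eq_map ν.parts fun y : ℕ => (y : ℚ) ^ (2 * k + 1))),
      MvPolynomial.psum, map_sum]
    refine Finset.sum_congr rfl fun i _ => ?_
    rw [map_pow, MvPolynomial.eval_X]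
    rfl
  | algebraMap c =>
    refine ⟨0, _, .const 0 c, fun ν => ?_⟩
    exact MvPolynomial.eval_C _
  | add f g _ _ ih₁ ih₂ =>
    obtain ⟨d₁, g₁, h₁, h₁'⟩ := ih₁
    obtain ⟨d₂, g₂, h₂, h₂'⟩ := ih₂
    refine ⟨max d₁ d₂, _, (h₁.mono (le_max_left _ _)).add (h₂.mono (le_max_right _ _)),
      fun ν => ?_⟩
    rw [← h₁', ← h₂']
    exact map_add _ _ _
  | mul f g _ _ ih₁ ih₂ =>
    obtain ⟨d₁, g₁, h₁, h₁'⟩ := ih₁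
    obtain ⟨d₂, g₂, h₂, h₂'⟩ := ih₂
    refine ⟨d₁ + d₂, _, h₁.mul h₂, fun ν => ?_⟩
    rw [← h₁', ← h₂']
    exact map_mul _ _ _

end ShiftedPlancherel

theorem theorem1p2 (μ : ShiftedPlancherel.StrictPartition)
    (f : ShiftedPlancherel.symmetricFunctions)
    (hf : f ∈ ShiftedPlancherel.supersymmetricFunctions) :
    ∃ p : Polynomial ℚ, ∀ n : ℕ,
      ShiftedPlancherel.average μ n (fun ν => ShiftedPlancherel.evalAt f ν) =
        p.eval (n : ℚ) := by
  obtain ⟨d, g, hg, hfg⟩ := ShiftedPlancherel.exists_hasDegreeLE_evalAt hf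
  simp only [hfg]
  exact hg.exists_polynomial_average μ
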